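/- Let $X\subset\mathbb R^n$ be a Borel set (state space), $U$ a finite nonempty set of points of a Euclidean space (action space), $\mathcal T(\cdot\mid x,u)$ a stochastic kernel from $X\times U$ to $X$ that is weak Feller (for every bounded continuous $g$ on $X$, $(x,u)\mapsto\int g\,d\mathcal T(\cdot\mid x,u)$ is continuous), $c:X\times U\to[0,\infty)$ bounded and continuous, $\|c\|_\infty=\sup_{x,u}|c(x,u)|$, and $0<\beta<1$. Assume there are $\alpha_c,\alpha_T>0$ such that for all $x,x'\in X$, $u\in U$, $$|c(x,u)-c(x',u)|\le\alpha_c\|x-x'\|_1,\qquad \|\mathcal T(\cdot\mid x,u)-\mathcal T(\cdot\mid x',u)\|_{TV}\le\alpha_T\|x-x'\|_1,$$ where $\|\mu-\nu\|_{TV}=\sup_A|\mu(A)-\nu(A)|$ over measurable sets $A$ (hence the result also holds for the normalization with an additional factor $2$). For an admissible policy $\gamma$ (a sequence of measurable maps $U_t=\gamma_t(X_0,\dots,X_t,U_0,\dots,U_{t-1})$) let $\mathbb P^{\gamma}_{x_0}$ be the law of the state-action process started at $X_0=x_0$, and let $J^*_\beta(x_0)=\inf_\gamma\mathbb E^\gamma_{x_0}\big[\sum_{t\ge0}\beta^tc(X_t,U_t)\big]$,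 the infimum being over all admissible policies. Let $\Gamma_s$ be the set of stationary policies $U_t=f(X_t)$, $f:X\to U$ measurable. For $\gamma_s\in\Gamma_s$ let $$\mu_\beta^{\gamma_s}(A)=(1-\beta)\sum_{t\ge0}\beta^t\,\mathbb P^{\gamma_s}_{x_0}(X_t\in A)$$ be the normalized discounted occupation measure on $X$ (it depends on $x_0$). Let $B_1,\dots,B_M$ be a measurable partition of $X$ and fix $x_0\in X$. Let $\gamma_0\in\Gamma_s$ be any reference stationary policy, and let $y_i\in X$ be a coordinatewise median of the bin $B_i$ under $\mu_\beta^{\gamma_0}$: for each coordinate $k$, both $B_i\cap\{x_k\le y_{i,k}\}$ and $B_i\cap\{x_k\ge y_{i,k}\}$ have $\mu_\beta^{\gamma_0}$-measure at least $\tfrac12\mu_\beta^{\gamma_0}(B_i)$. (A coordinatewise median need not lie in its bin; $y_i\in B_i$ is allowed but not required.) Consider the finite model on the bins in which the weighting measure of bin $i$ is the Dirac measure at $y_i$, that is, with stage cost $c(y_i,u)$ and transition probabilities $\mathcal T(B_j\mid y_i,u)$. Then its dynamic programming equation $$\hat J_\beta(i)=\inf_{u\in U}\Big\{c(y_i,u)+\beta\sum_{j=1}^M\hat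 J_\beta(j)\,\mathcal T(B_j\mid y_i,u)\Big\},\qquad i=1,\dots,M,$$ has a unique solution $\hat J_\beta:\{1,\dots,M\}\to\mathbb R$, and, extending it to $X$ by $\hat J_\beta(x)=\hat J_\beta(i)$ for $x\in B_i$, $$\big|\hat J_\beta(x_0)-J^*_\beta(x_0)\big|\le\Big(\alpha_c+\frac{\beta\alpha_T\|c\|_\infty}{1-\beta}\Big)\sup_{\gamma_s\in\Gamma_s}\frac1{1-\beta}\sum_{i=1}^M\int_{B_i}\|x-y_i\|_1\,\mu_\beta^{\gamma_s}(dx),$$ as an inequality in $[0,\infty]$. -/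

import Mathlib

open MeasureTheory ProbabilityTheory
open scoped ENNReal BoundedContinuousFunction

noncomputable section

namespace QuantizedMDP

/-! ### Distances and medians -/

/-- The distance `‖x - y‖₁ = ∑ₖ |xₖ - yₖ|` on `ℝⁿ`. -/
def l1Dist {n : ℕ} (x y : Fin n → ℝ) : ℝ := ∑ k, |x k - y k|

/-- Total variation distance of two finite measures, `sup_A |μ(A) - ν(A)|` over measurable `A`. -/
def tvDist {S : Type*} [MeasurableSpace S] (μ ν : Measure S) : ℝ :=
  ⨆ A : {A : Set S // MeasurableSet A}, |μ.real A.1 - ν.real A.1|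

/-- `m` is a coordinatewise median of the bin `B` under `μ`: for every coordinate `k`, at least half
of the mass of `B` lies in `{xₖ ≤ mₖ}` and at least half of it lies in `{xₖ ≥ mₖ}`. -/
def IsCoordMedian {n : ℕ} {X : Set (Fin n → ℝ)} (μ : Measure X) (B : Set X) (m : X) : Prop :=
  ∀ k, μ B ≤ 2 * μ (B ∩ {x | x.1 k ≤ m.1 k}) ∧ μ B ≤ 2 * μ (B ∩ {x | m.1 k ≤ x.1 k})

/-! ### Policies and the law of the controlled process -/

section Chain

variable {S A : Type*} [MeasurableSpace S] [MeasurableSpace A]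

variable (S A) in
/-- An admissible policy: at time `t` the action is a measurable function of
`(X₀, U₀), …, (Xₜ₋₁, Uₜ₋₁)` and `Xₜ`. -/
structure AdmissiblePolicy where
  act : ∀ t : ℕ, (Fin t → S × A) × S → A
  measurable_act : ∀ t, Measurable (act t)

variable (S A) in
/-- A stationary policy: a measurable map from states to actions. -/
structure StationaryPolicy where
  act : S → A
  measurable_act : Measurable act

/-- A stationary policy as an admissible policy, `Uₜ = f(Xₜ)`. -/
def StationaryPolicy.toAdmissible (f : StationaryPolicy S A) : AdmissiblePolicy S A where
  act _ p := f.act p.2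
  measurable_act _ := f.measurable_act.comp measurable_snd

/-- The action at time `t + 1`, from the state-action pairs up to time `t` and the state at time
`t + 1`. -/
def AdmissiblePolicy.nextAct (γ : AdmissiblePolicy S A) (t : ℕ)
    (p : (Finset.Iic t → S × A) × S) : A :=
  γ.act (t + 1) (fun i => p.1 ⟨i, Finset.mem_Iic.2 (Nat.lt_succ_iff.1 i.2)⟩, p.2)

lemma AdmissiblePolicy.measurable_nextAct (γ : AdmissiblePolicy S A) (t : ℕ) :
    Measurable (γ.nextAct t) := by
  refine (γ.measurable_act (t + 1)).comp (Measurable.prodMk ?_ measurable_snd)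
  exact measurable_pi_lambda _ fun i => (measurable_pi_apply _).comp measurable_fst

/-- The conditional law of `(Xₜ₊₁, Uₜ₊₁)` given the state-action pairs up to time `t`: draw
`Xₜ₊₁ ∼ T(· | Xₜ, Uₜ)` and apply the policy. -/
def stepKernel (T : Kernel (S × A) S) (γ : AdmissiblePolicy S A) (t : ℕ) :
    Kernel (Finset.Iic t → S × A) (S × A) :=
  (T.comap (fun h => h ⟨t, Finset.mem_Iic.2 le_rfl⟩) (measurable_pi_apply _)) ⊗ₖ
    Kernel.deterministic (γ.nextAct t) (γ.measurable_nextAct t)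

instance (T : Kernel (S × A) S) [IsMarkovKernel T] (γ : AdmissiblePolicy S A) (t : ℕ) :
    IsMarkovKernel (stepKernel T γ t) := by
  unfold stepKernel; infer_instance

/-- The law of the state-action process `(Xₜ, Uₜ)ₜ` started at `X₀ = x₀`, under the policy `γ` and
the transition kernel `T` (Ionescu-Tulcea). -/
def processLaw (T : Kernel (S × A) S) [IsMarkovKernel T] (γ : AdmissiblePolicy S A) (x₀ : S) :
    Measure (ℕ → S × A) :=
  Kernel.traj (X := fun _ => S × A) (stepKernel T γ) 0
    (fun _ => (x₀, γ.act 0 (Fin.elim0, x₀)))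

/-- The discounted cost `E [∑ₜ βᵗ c(Xₜ, Uₜ)]` of a policy. -/
def discountedCost (T : Kernel (S × A) S) [IsMarkovKernel T] (c : S → A → ℝ) (β : ℝ)
    (γ : AdmissiblePolicy S A) (x₀ : S) : ℝ :=
  ∫ ω, ∑' t : ℕ, β ^ t * c (ω t).1 (ω t).2 ∂(processLaw T γ x₀)

/-- The optimal discounted cost, an infimum over all admissible policies. -/
def optimalCost (T : Kernel (S × A) S) [IsMarkovKernel T] (c : S → A → ℝ) (β : ℝ) (x₀ : S) : ℝ :=
  ⨅ γ : AdmissiblePolicy S A, discountedCost T c β γ x₀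

/-- The discounted occupation measure `∑ₜ βᵗ P((Xₜ, Uₜ) ∈ ·)` on state-action pairs. -/
def occupationMeasure (T : Kernel (S × A) S) [IsMarkovKernel T] (β : ℝ)
    (γ : AdmissiblePolicy S A) (x₀ : S) : Measure (S × A) :=
  Measure.sum fun t : ℕ => ENNReal.ofReal (β ^ t) • (processLaw T γ x₀).map (fun ω => ω t)

/-- The normalized discounted occupation measure `(1 - β) ∑ₜ βᵗ P(Xₜ ∈ ·)` on states. -/
def stateOccupation (T : Kernel (S × A) S) [IsMarkovKernel T] (β : ℝ)
    (γ : AdmissiblePolicy S A) (x₀ : S) : Measure S :=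
  ENNReal.ofReal (1 - β) • (occupationMeasure T β γ x₀).map Prod.fst

/-! ### The finite model -/

/-- A quantizer: finitely many measurable bins that partition the state space. -/
structure IsPartition {M : ℕ} (B : Fin M → Set S) : Prop where
  measurableSet : ∀ i, MeasurableSet (B i)
  disjoint : ∀ i j, i ≠ j → Disjoint (B i) (B j)
  iUnion_eq : ⋃ i, B i = Set.univ

/-- The stage cost of the finite model, the average of `c(·, u)` under the weighting probability
measure `w i` of bin `i`. -/
def finiteCost {M : ℕ} (c : S → A → ℝ) (w : Fin M → Measure S) (i : Fin M) (u : A) : ℝ :=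
  ∫ x, c x u ∂(w i)

/-- The transition probability `P(j | i, u)` of the finite model, the average of `T(B j | ·, u)`
under the weighting probability measure `w i` of bin `i`. -/
def finiteTrans {M : ℕ} (T : Kernel (S × A) S) (B : Fin M → Set S) (w : Fin M → Measure S)
    (i : Fin M) (u : A) (j : Fin M) : ℝ :=
  ∫ x, (T (x, u)).real (B j) ∂(w i)

/-- `J` solves the discounted dynamic programming equation of the finite model. -/
def IsFiniteValue {M : ℕ} (T : Kernel (S × A) S) (c : S → A → ℝ) (β : ℝ) (B : Fin M → Set S)
    (w : Fin M → Measure S) (J : Fin M → ℝ) : Prop :=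
  ∀ i, J i = ⨅ u : A, (finiteCost c w i u + β * ∑ j, J j * finiteTrans T B w i u j)

open Classical in
/-- The extension of `J` to the state space that is constant on each bin. -/
def extendToStates {M : ℕ} (B : Fin M → Set S) (J : Fin M → ℝ) (x : S) : ℝ :=
  ∑ i, if x ∈ B i then J i else 0

end Chain

/-! ### Assumptions -/

/-- The cost is nonnegative, bounded and continuous and the kernel is weak Feller. -/
structure ModelAssumption {S A : Type*} [MeasurableSpace S] [MeasurableSpace A]
    [TopologicalSpace S] [TopologicalSpace A] (T : Kernel (S × A) S) (c : S → A → ℝ) : Prop where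
  cost_nonneg : ∀ x u, 0 ≤ c x u
  cost_bounded : ∃ K, ∀ x u, c x u ≤ K
  cost_continuous : Continuous (Function.uncurry c)
  weakFeller : ∀ g : S →ᵇ ℝ, Continuous fun p : S × A => ∫ x, g x ∂(T p)

/-- The cost and, in total variation, the kernel are Lipschitz in the state for `‖·‖₁`. -/
structure LipschitzAssumption {n : ℕ} {X : Set (Fin n → ℝ)} {A : Type*} [MeasurableSpace A]
    (T : Kernel (X × A) X) (c : X → A → ℝ) (αc αT : ℝ) : Prop where
  cost_lipschitz : ∀ x x' u, |c x u - c x' u| ≤ αc * l1Dist x.1 x'.1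
  kernel_lipschitz : ∀ x x' u, tvDist (T (x, u)) (T (x', u)) ≤ αT * l1Dist x.1 x'.1

/-- The supremum norm of the cost. -/
def costNorm {S A : Type*} (c : S → A → ℝ) : ℝ := ⨆ p : S × A, |c p.1 p.2|

end QuantizedMDP

end

namespace QuantizedMDP

/-! ### The controlled process and its discounted occupation measure -/

section StateActionProcess

variable {S A : Type*} [MeasurableSpace S] [MeasurableSpace A]
  (T : Kernel (S × A) S) [IsMarkovKernel T]

/-! Let `h` be the bin-wise constant extension of the finite value `J`, and let `Q(x, u)` be the
one-step cost in the true model with continuation `h`. With Dirac weights, the finite equation says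
exactly that `h(x) = min_u Q(y, u)`, where `y` is the representative of the bin of `x`. So `h`
solves the true Bellman equation except that the state is evaluated at `y` instead of `x`.

That displacement is cheap: `|Q(x, u) - Q(y, u)| ≤ L ‖x - y‖₁` (`oneStepCost_sub_le`, in both
orders). The cost contributes `αc`; the kernel contributes `β αT ‖c‖ / (1 - β)`, because `J` takes
values in `[0, ‖c‖ / (1 - β)]` (`finiteValue_mem_Icc`).

The performance difference identity `discountedCost_sub_eq` turns this local error into a global
one: the cost of a policy minus `h x₀` is the integral of the defect `Q(x, u) - h(x)` against the
occupation measure of that policy. Two stationary policies give the two sides. For an optimal one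
the defect is at least `-L ‖x - y‖₁`, which bounds `h x₀ - J*`. For the policy that is greedy in the
finite model it is at most `L ‖x - y‖₁`, which bounds `J* - h x₀`. Each is thus controlled by the
supremum over stationary policies; the first needs the optimum over all admissible policies to be
attained by a stationary one (`exists_optimal_stationaryPolicy`). -/

instance isProbabilityMeasure_processLaw (γ : AdmissiblePolicy S A) (x₀ : S) :
    IsProbabilityMeasure (processLaw T γ x₀) := by
  unfold processLaw; infer_instance

instance isProbabilityMeasure_map_eval (γ : AdmissiblePolicy S A) (x₀ : S) (t : ℕ) :
    IsProbabilityMeasure ((processLaw T γ x₀).map fun ω => ω t) :=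
  Measure.isProbabilityMeasure_map (measurable_pi_apply t).aemeasurable

lemma map_eval_zero_processLaw (γ : AdmissiblePolicy S A) (x₀ : S) :
    (processLaw T γ x₀).map (fun ω => ω 0) = Measure.dirac (x₀, γ.act 0 (Fin.elim0, x₀)) := by
  have hcomp : (fun ω : ℕ → S × A => ω 0) =
      (fun h : Finset.Iic 0 → S × A => h ⟨0, Finset.mem_Iic.2 le_rfl⟩) ∘
        Preorder.frestrictLe (π := fun _ => S × A) 0 := rfl
  rw [hcomp, ← Measure.map_map (measurable_pi_apply _) (by fun_prop), processLaw,
    Kernel.traj_map_frestrictLe_apply, Kernel.partialTraj_self, Kernel.id_apply,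
    Measure.map_dirac' (measurable_pi_apply _)]

/-- The law of the process at time `t + 1` in terms of the law of the history up to time `t`. -/
lemma map_eval_succ_processLaw (γ : AdmissiblePolicy S A) (x₀ : S) (t : ℕ) :
    (processLaw T γ x₀).map (fun ω => ω (t + 1)) =
      stepKernel T γ t ∘ₘ
        (processLaw T γ x₀).map (Preorder.frestrictLe (π := fun _ => S × A) t) := by
  have h := Kernel.traj_comp_partialTraj (X := fun _ => S × A) (κ := stepKernel T γ)
    (Nat.zero_le t)
  rw [processLaw, Kernel.traj_map_frestrictLe_apply, ← h, Kernel.comp_apply,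
    Measure.map_comp _ _ (measurable_pi_apply _), Kernel.map_traj_succ_self]

/-- The next state is distributed according to the transition kernel. -/
lemma map_fst_map_eval_succ (γ : AdmissiblePolicy S A) (x₀ : S) (t : ℕ) :
    ((processLaw T γ x₀).map (fun ω => ω (t + 1))).map Prod.fst =
      T ∘ₘ (processLaw T γ x₀).map (fun ω => ω t) := by
  have hstep : (stepKernel T γ t).map Prod.fst =
      T.comap (fun h => h ⟨t, Finset.mem_Iic.2 le_rfl⟩) (measurable_pi_apply _) :=
    (Kernel.fst_eq _).symm.trans (Kernel.fst_compProd _ _)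
  have hcomp : (fun ω : ℕ → S × A => ω t) =
      (fun h : Finset.Iic t → S × A => h ⟨t, Finset.mem_Iic.2 le_rfl⟩) ∘
        Preorder.frestrictLe (π := fun _ => S × A) t := rfl
  rw [map_eval_succ_processLaw, Measure.map_comp _ _ measurable_fst, hstep, hcomp,
    ← Measure.map_map (measurable_pi_apply _) (by fun_prop),
    ← Measure.deterministic_comp_eq_map (measurable_pi_apply _), Measure.comp_assoc,
    Kernel.comp_deterministic_eq_comap]

/-- Under a stationary policy the actions are almost surely those of the policy. -/
lemma ae_map_eval_toAdmissible [MeasurableEq A] (f : StationaryPolicy S A) (x₀ : S) (t : ℕ) :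
    ∀ᵐ p ∂(processLaw T f.toAdmissible x₀).map (fun ω => ω t), p.2 = f.act p.1 := by
  have hmeas : MeasurableSet {p : S × A | p.2 = f.act p.1} :=
    measurableSet_eq_fun measurable_snd (f.measurable_act.comp measurable_fst)
  cases t with
  | zero =>
    rw [map_eval_zero_processLaw, ae_dirac_iff hmeas]
    rfl
  | succ t =>
    rw [map_eval_succ_processLaw]
    refine Measure.ae_comp_of_ae_ae hmeas (ae_of_all _ fun h => ?_)
    refine Kernel.ae_compProd_of_ae_ae hmeas (ae_of_all _ fun x => ?_)
    rw [Kernel.deterministic_apply, ae_dirac_iff]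
    · rfl
    · exact hmeas.preimage measurable_prodMk_left

variable {β : ℝ}

lemma isFiniteMeasure_occupationMeasure (hβ₀ : 0 ≤ β) (hβ₁ : β < 1)
    (γ : AdmissiblePolicy S A) (x₀ : S) : IsFiniteMeasure (occupationMeasure T β γ x₀) := by
  constructor
  rw [occupationMeasure, Measure.sum_apply _ MeasurableSet.univ]
  simp only [Measure.smul_apply, measure_univ, smul_eq_mul, mul_one]
  rw [← ENNReal.ofReal_tsum_of_nonneg (fun t => pow_nonneg hβ₀ t)
    (summable_geometric_of_lt_one hβ₀ hβ₁)]
  exact ENNReal.ofReal_lt_top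

/-- An integral against the occupation measure is a discounted sum of expectations. -/
lemma hasSum_integral_occupationMeasure (hβ₀ : 0 ≤ β) (γ : AdmissiblePolicy S A) (x₀ : S)
    {φ : S × A → ℝ} (hφ : Integrable φ (occupationMeasure T β γ x₀)) :
    HasSum (fun t : ℕ => β ^ t * ∫ p, φ p ∂(processLaw T γ x₀).map (fun ω => ω t))
      (∫ p, φ p ∂occupationMeasure T β γ x₀) := by
  refine (hasSum_integral_measure hφ).congr_fun fun t => ?_
  rw [integral_smul_measure, ENNReal.toReal_ofReal (pow_nonneg hβ₀ _), smul_eq_mul]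

lemma integrable_occupationMeasure_of_bound (hβ₀ : 0 ≤ β) (hβ₁ : β < 1)
    (γ : AdmissiblePolicy S A) (x₀ : S) {φ : S × A → ℝ} (hφ : Measurable φ) {C : ℝ}
    (hC : ∀ p, |φ p| ≤ C) : Integrable φ (occupationMeasure T β γ x₀) := by
  have := isFiniteMeasure_occupationMeasure T hβ₀ hβ₁ γ x₀
  exact Integrable.of_bound hφ.aestronglyMeasurable C (ae_of_all _ hC)

lemma discountedCost_eq_integral_occupationMeasure (hβ₀ : 0 ≤ β) (hβ₁ : β < 1)
    (γ : AdmissiblePolicy S A) (x₀ : S) {c : S → A → ℝ} (hc : Measurable (Function.uncurry c))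
    {C : ℝ} (hC : ∀ x u, |c x u| ≤ C) :
    discountedCost T c β γ x₀ = ∫ p, c p.1 p.2 ∂occupationMeasure T β γ x₀ := by
  have hcomp (t : ℕ) : Measurable fun ω : ℕ → S × A => c (ω t).1 (ω t).2 :=
    hc.comp (measurable_pi_apply t)
  have hbound (t : ℕ) (ω : ℕ → S × A) : ‖β ^ t * c (ω t).1 (ω t).2‖ ≤ β ^ t * C := by
    rw [norm_mul, Real.norm_of_nonneg (pow_nonneg hβ₀ t)]
    exact mul_le_mul_of_nonneg_left (hC _ _) (pow_nonneg hβ₀ t)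
  have hgeom : Summable fun t : ℕ => β ^ t * C :=
    (summable_geometric_of_lt_one hβ₀ hβ₁).mul_right C
  have h₁ := hasSum_integral_of_dominated_convergence (μ := processLaw T γ x₀)
    (F := fun t ω => β ^ t * c (ω t).1 (ω t).2)
    (f := fun ω => ∑' t, β ^ t * c (ω t).1 (ω t).2) (fun t _ => β ^ t * C)
    (fun t => ((hcomp t).const_mul _).aestronglyMeasurable)
    (fun t => ae_of_all _ (hbound t)) (ae_of_all _ fun _ => hgeom) (integrable_const _)
    (ae_of_all _ fun ω => (hgeom.of_norm_bounded fun t => hbound t ω).hasSum)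
  have h₂ := hasSum_integral_occupationMeasure T hβ₀ γ x₀
    (integrable_occupationMeasure_of_bound T hβ₀ hβ₁ γ x₀ hc fun p => hC p.1 p.2)
  refine h₁.unique (h₂.congr_fun fun t => ?_)
  rw [integral_const_mul, integral_map (measurable_pi_apply t).aemeasurable
    hc.aestronglyMeasurable]
  rfl

/-- The one-step cost of taking action `u` in state `x` with continuation cost `h`. -/
noncomputable def oneStepCost (c : S → A → ℝ) (β : ℝ) (h : S → ℝ) (x : S) (u : A) : ℝ :=
  c x u + β * ∫ z, h z ∂(T (x, u))

omit [IsMarkovKernel T] in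
lemma measurable_integral_kernel [IsSFiniteKernel T] {h : S → ℝ} (hh : Measurable h) :
    Measurable fun p : S × A => ∫ z, h z ∂(T p) :=
  (StronglyMeasurable.integral_kernel_prod_right' (κ := T) (f := fun q => h q.2)
    (hh.comp measurable_snd).stronglyMeasurable).measurable

lemma abs_integral_kernel_le {h : S → ℝ} {H : ℝ} (hH : ∀ x, |h x| ≤ H) (p : S × A) :
    |∫ z, h z ∂(T p)| ≤ H := by
  simpa using norm_integral_le_of_norm_le_const (μ := T p) (f := h) (C := H) (ae_of_all _ hH)

omit [IsMarkovKernel T] in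
lemma integral_comp_measure [IsSFiniteKernel T] (μ : Measure (S × A)) [SFinite μ] {h : S → ℝ}
    (hh : Integrable h (T ∘ₘ μ)) : ∫ z, h z ∂(T ∘ₘ μ) = ∫ p, ∫ z, h z ∂(T p) ∂μ := by
  rw [← Measure.snd_compProd, Measure.snd] at hh ⊢
  rw [integral_map measurable_snd.aemeasurable hh.aestronglyMeasurable]
  exact Measure.integral_compProd (f := fun q => h q.2) (hh.comp_measurable measurable_snd)

/-- A telescoping sum: `βᵗ⁺¹ E h(Xₜ₊₁)` cancels against `β · βᵗ E (Th)(Xₜ, Uₜ)`, and only the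
initial term survives. Equivalently, the state marginal of the occupation measure `ν` is `δ_{x₀} + β
(T ∘ₘ ν)`. -/
lemma integral_bellman_occupationMeasure (hβ₀ : 0 ≤ β) (hβ₁ : β < 1)
    (γ : AdmissiblePolicy S A) (x₀ : S) {h : S → ℝ} (hh : Measurable h) {H : ℝ}
    (hH : ∀ x, |h x| ≤ H) :
    ∫ p, (h p.1 - β * ∫ z, h z ∂(T p)) ∂occupationMeasure T β γ x₀ = h x₀ := by
  have hT := measurable_integral_kernel T hh
  have hfst : Measurable fun p : S × A => h p.1 := hh.comp measurable_fst
  have hsum₁ := hasSum_integral_occupationMeasure T hβ₀ γ x₀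
    (integrable_occupationMeasure_of_bound T hβ₀ hβ₁ γ x₀ hfst fun p => hH p.1)
  have hiT := integrable_occupationMeasure_of_bound T hβ₀ hβ₁ γ x₀ hT
    (abs_integral_kernel_le T hH)
  have hsum₂ := (hasSum_integral_occupationMeasure T hβ₀ γ x₀ hiT).mul_left β
  have hstep (t : ℕ) :
      ∫ p, h p.1 ∂(processLaw T γ x₀).map (fun ω => ω (t + 1)) =
        ∫ p, ∫ z, h z ∂(T p) ∂(processLaw T γ x₀).map (fun ω => ω t) := by
    rw [← integral_map (φ := Prod.fst) measurable_fst.aemeasurable hh.aestronglyMeasurable,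
      map_fst_map_eval_succ]
    exact integral_comp_measure T _ (Integrable.of_bound hh.aestronglyMeasurable H (ae_of_all _ hH))
  have hsum₃ : HasSum
      (fun t : ℕ => β ^ (t + 1) * ∫ p, h p.1 ∂(processLaw T γ x₀).map (fun ω => ω (t + 1)))
      (β * ∫ p, ∫ z, h z ∂(T p) ∂occupationMeasure T β γ x₀) :=
    hsum₂.congr_fun fun t => by rw [hstep, pow_succ']; ring
  -- The series for `h` without its term at time `0` is the series for `β Th`.
  have hzero := (hasSum_nat_add_iff' 1).2 hsum₁ |>.unique hsum₃
  rw [Finset.sum_range_one, map_eval_zero_processLaw,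
    integral_dirac' _ _ hfst.stronglyMeasurable] at hzero
  rw [integral_sub (integrable_occupationMeasure_of_bound T hβ₀ hβ₁ γ x₀ hfst fun p => hH p.1)
    (hiT.const_mul β), integral_const_mul, ← hzero]
  simp

/-- The performance difference identity: the discounted cost of a policy minus `h x₀` is the
accumulated Bellman defect of `h` along the policy. -/
lemma discountedCost_sub_eq (hβ₀ : 0 ≤ β) (hβ₁ : β < 1)
    (γ : AdmissiblePolicy S A) (x₀ : S) {c : S → A → ℝ} (hc : Measurable (Function.uncurry c))
    {C : ℝ} (hC : ∀ x u, |c x u| ≤ C) {h : S → ℝ} (hh : Measurable h) {H : ℝ}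
    (hH : ∀ x, |h x| ≤ H) :
    discountedCost T c β γ x₀ - h x₀ =
      ∫ p, (oneStepCost T c β h p.1 p.2 - h p.1) ∂occupationMeasure T β γ x₀ := by
  have hic := integrable_occupationMeasure_of_bound T hβ₀ hβ₁ γ x₀
    (φ := fun p => c p.1 p.2) hc fun p => hC p.1 p.2
  have hih := integrable_occupationMeasure_of_bound T hβ₀ hβ₁ γ x₀ (φ := fun p => h p.1)
    (hh.comp measurable_fst) fun p => hH p.1
  have hiT := integrable_occupationMeasure_of_bound T hβ₀ hβ₁ γ x₀
    (measurable_integral_kernel T hh) (abs_integral_kernel_le T hH)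
  rw [discountedCost_eq_integral_occupationMeasure T hβ₀ hβ₁ γ x₀ hc hC]
  nth_rw 1 [← integral_bellman_occupationMeasure T hβ₀ hβ₁ γ x₀ hh hH]
  rw [← integral_sub hic (hih.sub' (hiT.const_mul β))]
  refine integral_congr_ae (ae_of_all _ fun p => ?_)
  simp only [oneStepCost]
  ring

lemma ae_occupationMeasure_toAdmissible [MeasurableEq A] (f : StationaryPolicy S A) (x₀ : S) :
    ∀ᵐ p ∂occupationMeasure T β f.toAdmissible x₀, p.2 = f.act p.1 := by
  have hmeas : MeasurableSet {p : S × A | p.2 = f.act p.1} :=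
    measurableSet_eq_fun measurable_snd (f.measurable_act.comp measurable_fst)
  rw [occupationMeasure, Measure.ae_sum_iff' hmeas]
  exact fun t => Measure.ae_smul_measure (ae_map_eval_toAdmissible T f x₀ t) _

end StateActionProcess

/-! ### Existence of an optimal stationary policy -/

section Optimality

/-- Each infimum is attained, so it can be compared with the other family at its own minimizer. This
makes both Bellman operators contractions. -/
lemma abs_ciInf_sub_ciInf_le {ι : Type*} [Finite ι] [Nonempty ι] {a b : ι → ℝ} {ε : ℝ}
    (h : ∀ i, |a i - b i| ≤ ε) : |(⨅ i, a i) - ⨅ i, b i| ≤ ε := by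
  obtain ⟨i, hi⟩ := exists_eq_ciInf_of_finite (f := a)
  obtain ⟨j, hj⟩ := exists_eq_ciInf_of_finite (f := b)
  have h₁ := ciInf_le (Set.finite_range a).bddBelow j
  have h₂ := ciInf_le (Set.finite_range b).bddBelow i
  have h₃ := abs_le.1 (h i)
  have h₄ := abs_le.1 (h j)
  rw [abs_le]
  constructor <;> linarith

variable {S A : Type*} [MeasurableSpace S] [MeasurableSpace A]
  (T : Kernel (S × A) S) [IsMarkovKernel T]

/-- Measurable selection of a minimizing action when there are finitely many actions. -/
lemma exists_stationaryPolicy_eq_ciInf [Finite A] [Nonempty A] {Q : S → A → ℝ}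
    (hQ : ∀ u, Measurable fun x => Q x u) :
    ∃ f : StationaryPolicy S A, ∀ x, Q x (f.act x) = ⨅ u, Q x u := by
  classical
  -- The selector takes the minimizer of least index in an enumeration by `ℕ`. Every map out of `ℕ`
  -- is measurable, so nothing is required of the σ-algebra on the actions.
  obtain ⟨e, he⟩ := exists_surjective_nat A
  have hex (x : S) : ∃ k, ∀ u, Q x (e k) ≤ Q x u := by
    obtain ⟨a, ha⟩ := Finite.exists_min (Q x)
    obtain ⟨k, rfl⟩ := he a
    exact ⟨k, ha⟩
  have hmeas (k : ℕ) : MeasurableSet {x | ∀ u, Q x (e k) ≤ Q x u} := by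
    rw [Set.ofPred_forall]
    exact MeasurableSet.iInter fun u => measurableSet_le (hQ _) (hQ _)
  refine ⟨⟨fun x => e (Nat.find (hex x)), measurable_from_nat.comp (measurable_find hex hmeas)⟩,
    fun x => le_antisymm (le_ciInf (Nat.find_spec (hex x))) ?_⟩
  exact ciInf_le (Set.finite_range (Q x)).bddBelow _

lemma abs_oneStepCost_sub_le {c : S → A → ℝ} {β : ℝ} (hβ₀ : 0 ≤ β) {h h' : S → ℝ} {ε : ℝ}
    (hh : ∀ p, Integrable h (T p)) (hh' : ∀ p, Integrable h' (T p)) (hε : ∀ x, |h x - h' x| ≤ ε)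
    (x : S) (u : A) : |oneStepCost T c β h x u - oneStepCost T c β h' x u| ≤ β * ε := by
  have hint := norm_integral_le_of_norm_le_const (μ := T (x, u)) (f := fun z => h z - h' z)
    (C := ε) (ae_of_all _ hε)
  rw [integral_sub (hh _) (hh' _)] at hint
  simp only [probReal_univ, mul_one, Real.norm_eq_abs] at hint
  have heq : oneStepCost T c β h x u - oneStepCost T c β h' x u =
      β * (∫ z, h z ∂(T (x, u)) - ∫ z, h' z ∂(T (x, u))) := by
    simp only [oneStepCost]; ring
  rw [heq, abs_mul, abs_of_nonneg hβ₀]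
  exact mul_le_mul_of_nonneg_left hint hβ₀

omit [IsMarkovKernel T] in
lemma measurable_oneStepCost [IsSFiniteKernel T] {c : S → A → ℝ} (β : ℝ)
    (hc : Measurable (Function.uncurry c)) {h : S → ℝ} (hh : Measurable h) :
    Measurable fun p : S × A => oneStepCost T c β h p.1 p.2 :=
  Measurable.add hc ((measurable_integral_kernel T hh).const_mul β)

lemma abs_oneStepCost_le {c : S → A → ℝ} {C : ℝ} (hC : ∀ x u, |c x u| ≤ C)
    {β : ℝ} (hβ₀ : 0 ≤ β) {h : S → ℝ} {H : ℝ} (hH : ∀ x, |h x| ≤ H) (x : S) (u : A) :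
    |oneStepCost T c β h x u| ≤ C + β * H := by
  refine (abs_add_le _ _).trans (add_le_add (hC x u) ?_)
  rw [abs_mul, abs_of_nonneg hβ₀]
  exact mul_le_mul_of_nonneg_left (abs_integral_kernel_le T hH _) hβ₀

variable [TopologicalSpace S] [OpensMeasurableSpace S] [TopologicalSpace A]
  [Finite A] [Nonempty A]

/-- The Bellman equation of a weak Feller model with finitely many actions has a bounded continuous
solution. -/
lemma exists_bellman_solution {c : S → A → ℝ} (hmodel : ModelAssumption T c) {β : ℝ}
    (hβ₀ : 0 ≤ β) (hβ₁ : β < 1) {C : ℝ} (hC : ∀ x u, |c x u| ≤ C) :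
    ∃ V : S →ᵇ ℝ, ∀ x, V x = ⨅ u, oneStepCost T c β V x u := by
  cases nonempty_fintype A
  -- The weak Feller property and the finiteness of the minimum keep the Bellman operator inside the
  -- bounded continuous functions, a complete space where Banach's theorem applies.
  have hcont (h : S →ᵇ ℝ) : Continuous fun x => ⨅ u, oneStepCost T c β h x u := by
    simp_rw [← Finset.inf'_univ_eq_ciInf]
    refine Continuous.finset_inf'_apply _ fun u _ => ?_
    have hu : Continuous fun x : S => (x, u) := by fun_prop
    exact (hmodel.cost_continuous.comp hu).add
      (((hmodel.weakFeller h).comp hu).const_mul β)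
  have hbound (h : S →ᵇ ℝ) (x : S) :
      ‖⨅ u, oneStepCost T c β h x u‖ ≤ C + β * ‖h‖ := by
    obtain ⟨u, hu⟩ := exists_eq_ciInf_of_finite (f := fun u => oneStepCost T c β h x u)
    rw [← hu]
    exact abs_oneStepCost_le T hC hβ₀ h.norm_coe_le_norm x u
  let F (h : S →ᵇ ℝ) : S →ᵇ ℝ :=
    BoundedContinuousFunction.ofNormedAddCommGroup _ (hcont h) _ (hbound h)
  have hF : ContractingWith ⟨β, hβ₀⟩ F := by
    refine ⟨hβ₁, LipschitzWith.of_dist_le_mul fun h h' => ?_⟩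
    refine (BoundedContinuousFunction.dist_le (by positivity)).2 fun x => ?_
    refine abs_ciInf_sub_ciInf_le fun u => ?_
    exact abs_oneStepCost_sub_le T hβ₀ (fun p => h.integrable (T p))
      (fun p => h'.integrable (T p)) (fun z => h.dist_coe_le_dist (g := h') z) x u
  exact ⟨hF.fixedPoint, fun x => (DFunLike.congr_fun hF.fixedPoint_isFixedPt x).symm⟩

/-- A weak Feller model with finitely many actions has an optimal stationary policy. -/
lemma exists_optimal_stationaryPolicy [MeasurableEq A] {c : S → A → ℝ}
    (hmodel : ModelAssumption T c) (hc : Measurable (Function.uncurry c)) {β : ℝ}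
    (hβ₀ : 0 ≤ β) (hβ₁ : β < 1) {C : ℝ} (hC : ∀ x u, |c x u| ≤ C) (x₀ : S) :
    ∃ f : StationaryPolicy S A,
      optimalCost T c β x₀ = discountedCost T c β f.toAdmissible x₀ ∧
      ∀ γ, optimalCost T c β x₀ ≤ discountedCost T c β γ x₀ := by
  obtain ⟨V, hV⟩ := exists_bellman_solution T hmodel hβ₀ hβ₁ hC
  have hVm : Measurable V := V.continuous.measurable
  obtain ⟨f, hf⟩ := exists_stationaryPolicy_eq_ciInf (Q := oneStepCost T c β V) fun u =>
    (measurable_oneStepCost T β hc hVm).comp measurable_prodMk_right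
  have hdiff (γ : AdmissiblePolicy S A) :=
    discountedCost_sub_eq T hβ₀ hβ₁ γ x₀ hc hC hVm V.norm_coe_le_norm
  -- The Bellman defect of `V` is nonnegative for every action, and it vanishes almost surely along
  -- a greedy policy.
  have hle (γ : AdmissiblePolicy S A) : V x₀ ≤ discountedCost T c β γ x₀ := by
    rw [← sub_nonneg, hdiff]
    refine integral_nonneg fun p => sub_nonneg.2 ?_
    rw [hV]
    exact ciInf_le (Set.finite_range _).bddBelow p.2
  have hfV : discountedCost T c β f.toAdmissible x₀ = V x₀ := by
    rw [← sub_eq_zero, hdiff]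
    refine integral_eq_zero_of_ae ?_
    filter_upwards [ae_occupationMeasure_toAdmissible T f x₀] with p hp
    rw [hp, hf, ← hV, sub_self, Pi.zero_apply]
  have hbdd : BddBelow (Set.range fun γ => discountedCost T c β γ x₀) :=
    ⟨V x₀, by rintro _ ⟨γ, rfl⟩; exact hle γ⟩
  have : Nonempty (AdmissiblePolicy S A) := ⟨f.toAdmissible⟩
  refine ⟨f, le_antisymm (ciInf_le hbdd _) ?_, ciInf_le hbdd⟩
  rw [hfV]
  exact le_ciInf hle

end Optimality

/-! ### Bin-wise constant functions and the finite model -/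

section FiniteModel

variable {S A : Type*} [MeasurableSpace S] {M : ℕ} {B : Fin M → Set S}

lemma IsPartition.exists_mem (hB : IsPartition B) (x : S) : ∃ i, x ∈ B i := by
  have hx : x ∈ ⋃ i, B i := hB.iUnion_eq ▸ Set.mem_univ x
  exact Set.mem_iUnion.1 hx

lemma IsPartition.extendToStates_eq (hB : IsPartition B) (J : Fin M → ℝ) {x : S} {i : Fin M}
    (hx : x ∈ B i) : extendToStates B J x = J i := by
  classical
  rw [extendToStates, Finset.sum_eq_single i]
  · exact if_pos hx
  · exact fun j _ hj => if_neg fun hxj => Set.disjoint_left.1 (hB.disjoint j i hj) hxj hx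
  · exact fun hi => absurd (Finset.mem_univ i) hi

lemma IsPartition.measurable_extendToStates (hB : IsPartition B) (J : Fin M → ℝ) :
    Measurable (extendToStates B J) :=
  Finset.measurable_fun_sum _ fun i _ =>
    Measurable.ite (hB.measurableSet i) measurable_const measurable_const

lemma IsPartition.abs_extendToStates_le (hB : IsPartition B) (J : Fin M → ℝ) (x : S) :
    |extendToStates B J x| ≤ ‖J‖ := by
  obtain ⟨i, hi⟩ := hB.exists_mem x
  rw [hB.extendToStates_eq J hi]
  exact norm_le_pi_norm J i

lemma IsPartition.integrable_extendToStates (hB : IsPartition B) (J : Fin M → ℝ) (μ : Measure S)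
    [IsFiniteMeasure μ] : Integrable (extendToStates B J) μ :=
  Integrable.of_bound (hB.measurable_extendToStates J).aestronglyMeasurable ‖J‖
    (ae_of_all _ (hB.abs_extendToStates_le J))

lemma IsPartition.integral_extendToStates (hB : IsPartition B) (J : Fin M → ℝ) (μ : Measure S)
    [IsFiniteMeasure μ] : ∫ x, extendToStates B J x ∂μ = ∑ j, J j * μ.real (B j) := by
  classical
  have hind (j : Fin M) : (fun x => if x ∈ B j then J j else 0) = (B j).indicator fun _ => J j := by
    ext x; simp [Set.indicator_apply]
  simp only [extendToStates]
  rw [integral_finsetSum]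
  · refine Finset.sum_congr rfl fun j _ => ?_
    have := integral_indicator_const (μ := μ) (J j) (hB.measurableSet j)
    rw [smul_eq_mul, mul_comm] at this
    rw [← this, ← hind]
  · intro j _
    have := (integrable_const (μ := μ) (J j)).indicator (hB.measurableSet j)
    rw [← hind] at this
    convert! this

lemma abs_sub_le_tvDist (μ ν : Measure S) [IsProbabilityMeasure μ] [IsProbabilityMeasure ν]
    {E : Set S} (hE : MeasurableSet E) : |μ.real E - ν.real E| ≤ tvDist μ ν := by
  -- A real supremum defaults to `0` on unbounded families, so boundedness must be checked.
  have hbdd : BddAbove (Set.range fun E : {E : Set S // MeasurableSet E} =>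
      |μ.real E.1 - ν.real E.1|) := by
    refine ⟨1, ?_⟩
    rintro _ ⟨E, rfl⟩
    have h₁ := measureReal_le_one (μ := μ) (s := E.1)
    have h₂ := measureReal_le_one (μ := ν) (s := E.1)
    have h₃ := measureReal_nonneg (μ := μ) (s := E.1)
    have h₄ := measureReal_nonneg (μ := ν) (s := E.1)
    exact abs_le.2 ⟨by linarith, by linarith⟩
  exact le_ciSup hbdd ⟨E, hE⟩

/-- Integrals of a bin-wise constant function with values in `[0, K]` differ by at most `K` times
the total variation distance. -/
lemma IsPartition.integral_sub_le (hB : IsPartition B) {J : Fin M → ℝ} {K : ℝ}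
    (hJ₀ : ∀ i, 0 ≤ J i) (hJ : ∀ i, J i ≤ K) (hK : 0 ≤ K) (μ ν : Measure S)
    [IsProbabilityMeasure μ] [IsProbabilityMeasure ν] :
    ∫ x, extendToStates B J x ∂μ - ∫ x, extendToStates B J x ∂ν ≤ K * tvDist μ ν := by
  classical
  -- The bins on which `μ - ν` is nonnegative, as in a Hahn decomposition. As `J ≥ 0`, the other
  -- bins can be dropped, so one test set suffices and the constant is `K` rather than `2K`.
  set s : Finset (Fin M) := {j | 0 ≤ μ.real (B j) - ν.real (B j)}
  have hunion (ρ : Measure S) [IsFiniteMeasure ρ] :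
      ρ.real (⋃ j ∈ s, B j) = ∑ j ∈ s, ρ.real (B j) :=
    measureReal_biUnion_finset (fun i _ j _ hij => hB.disjoint i j hij)
      fun j _ => hB.measurableSet j
  calc ∫ x, extendToStates B J x ∂μ - ∫ x, extendToStates B J x ∂ν
      = ∑ j, J j * (μ.real (B j) - ν.real (B j)) := by
        rw [hB.integral_extendToStates, hB.integral_extendToStates, ← Finset.sum_sub_distrib]
        simp only [mul_sub]
    _ ≤ ∑ j, if 0 ≤ μ.real (B j) - ν.real (B j) then K * (μ.real (B j) - ν.real (B j)) else 0 := by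
        refine Finset.sum_le_sum fun j _ => ?_
        split_ifs with h
        · exact mul_le_mul_of_nonneg_right (hJ j) h
        · exact mul_nonpos_of_nonneg_of_nonpos (hJ₀ j) (not_le.1 h).le
    _ = K * (μ.real (⋃ j ∈ s, B j) - ν.real (⋃ j ∈ s, B j)) := by
        rw [hunion, hunion, ← Finset.sum_sub_distrib, Finset.mul_sum, Finset.sum_filter]
    _ ≤ K * tvDist μ ν := by
        refine mul_le_mul_of_nonneg_left ((le_abs_self _).trans (abs_sub_le_tvDist μ ν ?_)) hK
        exact s.measurableSet_biUnion fun j _ => hB.measurableSet j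

variable [MeasurableSingletonClass S] [MeasurableSpace A]
  (T : Kernel (S × A) S) [IsMarkovKernel T]

/-- Averaging against a Dirac measure is evaluation, so the finite equation is the true Bellman
operator applied to a bin-wise constant function and sampled at the points `y i`. -/
lemma IsPartition.isFiniteValue_dirac_iff (hB : IsPartition B) (c : S → A → ℝ) (β : ℝ)
    (y : Fin M → S) (J : Fin M → ℝ) :
    IsFiniteValue T c β B (fun i => Measure.dirac (y i)) J ↔
      ∀ i, J i = ⨅ u, oneStepCost T c β (extendToStates B J) (y i) u := by
  simp only [IsFiniteValue, finiteCost, finiteTrans, oneStepCost, integral_dirac,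
    hB.integral_extendToStates]

/-- The dynamic programming equation of the finite model is well posed. -/
lemma IsPartition.existsUnique_isFiniteValue_dirac [Finite A] [Nonempty A] (hB : IsPartition B)
    (c : S → A → ℝ) {β : ℝ} (hβ₀ : 0 ≤ β) (hβ₁ : β < 1) (y : Fin M → S) :
    ∃! J : Fin M → ℝ, IsFiniteValue T c β B (fun i => Measure.dirac (y i)) J := by
  let F (J : Fin M → ℝ) (i : Fin M) : ℝ := ⨅ u, oneStepCost T c β (extendToStates B J) (y i) u
  have hF : ContractingWith ⟨β, hβ₀⟩ F := by
    refine ⟨hβ₁, LipschitzWith.of_dist_le_mul fun J J' => ?_⟩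
    refine (dist_pi_le_iff (by positivity)).2 fun i => ?_
    refine abs_ciInf_sub_ciInf_le fun u => ?_
    refine abs_oneStepCost_sub_le T hβ₀ (fun p => hB.integrable_extendToStates J _)
      (fun p => hB.integrable_extendToStates J' _) (fun x => ?_) _ u
    obtain ⟨j, hj⟩ := hB.exists_mem x
    rw [hB.extendToStates_eq J hj, hB.extendToStates_eq J' hj]
    exact dist_le_pi_dist J J' j
  have hiff := hB.isFiniteValue_dirac_iff T c β y
  exact ⟨hF.fixedPoint, (hiff _).2 fun i => (congrFun hF.fixedPoint_isFixedPt i).symm,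
    fun J hJ => hF.fixedPoint_unique (funext fun i => ((hiff J).1 hJ i).symm)⟩

omit [MeasurableSingletonClass S] in
-- A maximum principle: at a minimizing bin `a` the equation gives `J a ≥ β J a`, and at a
-- maximizing bin `b` it gives `J b ≤ C + β J b`.
lemma IsPartition.finiteValue_mem_Icc [Finite A] [Nonempty A] (hB : IsPartition B)
    {c : S → A → ℝ} {C β : ℝ} (hc₀ : ∀ x u, 0 ≤ c x u) (hC : ∀ x u, c x u ≤ C)
    (hβ₀ : 0 ≤ β) (hβ₁ : β < 1) (y : Fin M → S) {J : Fin M → ℝ}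
    (hJ : ∀ i, J i = ⨅ u, oneStepCost T c β (extendToStates B J) (y i) u) (i : Fin M) :
    J i ∈ Set.Icc 0 (C / (1 - β)) := by
  have : Nonempty (Fin M) := ⟨i⟩
  obtain ⟨a, ha⟩ := Finite.exists_min J
  obtain ⟨b, hb⟩ := Finite.exists_max J
  have hlow (p : S × A) : J a ≤ ∫ z, extendToStates B J z ∂(T p) := by
    have := integral_mono (integrable_const (μ := T p) (J a))
      (hB.integrable_extendToStates J (T p)) fun z => by
        obtain ⟨j, hj⟩ := hB.exists_mem z
        simpa only [hB.extendToStates_eq J hj] using ha j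
    simpa using this
  have hhigh (p : S × A) : ∫ z, extendToStates B J z ∂(T p) ≤ J b := by
    have := integral_mono (hB.integrable_extendToStates J (T p))
      (integrable_const (μ := T p) (J b)) fun z => by
        obtain ⟨j, hj⟩ := hB.exists_mem z
        simpa only [hB.extendToStates_eq J hj] using hb j
    simpa using this
  have h₁ : β * J a ≤ J a := by
    conv_rhs => rw [hJ a]
    refine le_ciInf fun u => ?_
    have := mul_le_mul_of_nonneg_left (hlow (y a, u)) hβ₀
    have := hc₀ (y a) u
    simp only [oneStepCost]
    linarith
  have h₂ : J b ≤ C + β * J b := by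
    obtain ⟨u⟩ := ‹Nonempty A›
    conv_lhs => rw [hJ b]
    refine (ciInf_le (Set.finite_range _).bddBelow u).trans ?_
    exact add_le_add (hC _ _) (mul_le_mul_of_nonneg_left (hhigh _) hβ₀)
  constructor
  · exact le_trans (by nlinarith) (ha i)
  · exact (hb i).trans ((le_div_iff₀ (by linarith)).2 (by linarith))

end FiniteModel

/-! ### From the local Lipschitz error to an occupation integral -/

section ErrorBound

lemma l1Dist_comm {n : ℕ} (x y : Fin n → ℝ) : l1Dist x y = l1Dist y x :=
  Finset.sum_congr rfl fun _ _ => abs_sub_comm _ _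

lemma measurable_l1Dist_left {n : ℕ} {X : Set (Fin n → ℝ)} (y : Fin n → ℝ) :
    Measurable fun x : X => l1Dist x.1 y := by
  refine Finset.measurable_fun_sum _ fun k _ => ?_
  exact continuous_abs.measurable.comp
    (((measurable_pi_apply k).comp measurable_subtype_coe).sub_const _)

lemma ofReal_integral_le_lintegral_ofReal {α : Type*} [MeasurableSpace α] {μ : Measure α}
    {g : α → ℝ} (hg : Integrable g μ) :
    ENNReal.ofReal (∫ a, g a ∂μ) ≤ ∫⁻ a, ENNReal.ofReal (g a) ∂μ := by
  rw [integral_eq_lintegral_pos_part_sub_lintegral_neg_part hg]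
  refine (ENNReal.ofReal_le_ofReal (sub_le_self _ ENNReal.toReal_nonneg)).trans ?_
  exact ENNReal.ofReal_toReal_le

/-- Here `g` will be a bounded defect and `d` the distance to the representative, which need not be
integrable when the state space is unbounded. The passage to `[0, ∞]` therefore asks for
integrability of `g` only. -/
lemma ofReal_integral_le_mul_lintegral {α : Type*} [MeasurableSpace α] {μ : Measure α}
    {g d : α → ℝ} (hg : Integrable g μ) {L : ℝ} (hL : 0 ≤ L) (hgd : ∀ᵐ a ∂μ, g a ≤ L * d a) :
    ENNReal.ofReal (∫ a, g a ∂μ) ≤ ENNReal.ofReal L * ∫⁻ a, ENNReal.ofReal (d a) ∂μ := by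
  rw [← lintegral_const_mul' _ _ ENNReal.ofReal_ne_top]
  refine (ofReal_integral_le_lintegral_ofReal hg).trans (lintegral_mono_ae ?_)
  filter_upwards [hgd] with a ha
  rw [← ENNReal.ofReal_mul hL]
  exact ENNReal.ofReal_le_ofReal ha

variable {S A : Type*} [MeasurableSpace S] [MeasurableSpace A]

/-- Bin-wise integrals against the normalized state occupation measure, rescaled, as one integral
against the occupation measure. -/
lemma IsPartition.sum_setLIntegral_stateOccupation {M : ℕ} {B : Fin M → Set S} (hB : IsPartition B)
    (T : Kernel (S × A) S) [IsMarkovKernel T] {β : ℝ} (hβ₁ : β < 1) (γ : AdmissiblePolicy S A)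
    (x₀ : S) {d : Fin M → S → ℝ≥0∞} (hd : ∀ i, Measurable (d i)) {bin : S → Fin M}
    (hbin : ∀ x, x ∈ B (bin x)) :
    ENNReal.ofReal (1 / (1 - β)) * ∑ i, ∫⁻ x in B i, d i x ∂stateOccupation T β γ x₀ =
      ∫⁻ p, d (bin p.1) p.1 ∂occupationMeasure T β γ x₀ := by
  have hset (i : Fin M) : MeasurableSet (Prod.fst ⁻¹' B i : Set (S × A)) :=
    measurable_fst (hB.measurableSet i)
  -- The prefactor of the bound undoes the normalization of the state occupation measure.
  have hone : ENNReal.ofReal (1 / (1 - β)) * ENNReal.ofReal (1 - β) = 1 := by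
    have : 0 < 1 - β := by linarith
    rw [← ENNReal.ofReal_mul (by positivity), one_div_mul_cancel this.ne', ENNReal.ofReal_one]
  have hterm (i : Fin M) : ENNReal.ofReal (1 / (1 - β)) *
      ∫⁻ x in B i, d i x ∂stateOccupation T β γ x₀ =
      ∫⁻ p in Prod.fst ⁻¹' B i, d (bin p.1) p.1 ∂occupationMeasure T β γ x₀ := by
    rw [stateOccupation, Measure.restrict_smul, lintegral_smul_measure, smul_eq_mul, ← mul_assoc,
      hone, one_mul, setLIntegral_map (hB.measurableSet i) (hd i) measurable_fst]
    refine setLIntegral_congr_fun (hset i) fun p hp => ?_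
    have hi : bin p.1 = i := by
      by_contra hne
      exact Set.disjoint_left.1 (hB.disjoint _ _ hne) (hbin p.1) hp
    simp only [hi]
  rw [Finset.mul_sum, Finset.sum_congr rfl fun i _ => hterm i,
    ← tsum_fintype (L := .unconditional _),
    ← lintegral_iUnion hset fun i j hij => (hB.disjoint i j hij).preimage Prod.fst,
    ← Set.preimage_iUnion, hB.iUnion_eq, Set.preimage_univ, Measure.restrict_univ]

/-- Inside a bin, replacing the state by another point costs at most a Lipschitz error in the
Bellman operator of the finite model. -/
lemma oneStepCost_sub_le {n M : ℕ} {X : Set (Fin n → ℝ)} {T : Kernel (X × A) X} [IsMarkovKernel T]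
    {c : X → A → ℝ} {αc αT : ℝ} (hlip : LipschitzAssumption T c αc αT) {B : Fin M → Set X}
    (hB : IsPartition B) {β K : ℝ} (hβ₀ : 0 ≤ β) (hK : 0 ≤ K) {J : Fin M → ℝ}
    (hJ : ∀ i, J i ∈ Set.Icc 0 K) (x x' : X) (u : A) :
    oneStepCost T c β (extendToStates B J) x u - oneStepCost T c β (extendToStates B J) x' u ≤
      (αc + β * αT * K) * l1Dist x.1 x'.1 := by
  have h₁ := (le_abs_self _).trans (hlip.cost_lipschitz x x' u)
  have h₂ := hB.integral_sub_le (fun i => (hJ i).1) (fun i => (hJ i).2) hK (T (x, u)) (T (x', u))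
  have h₃ := mul_le_mul_of_nonneg_left
    (h₂.trans (mul_le_mul_of_nonneg_left (hlip.kernel_lipschitz x x' u) hK)) hβ₀
  simp only [oneStepCost]
  linarith

end ErrorBound

end QuantizedMDP

/-! ### The error bound for the quantized model -/

open QuantizedMDP

theorem mainTheorem8 {n m M : ℕ}
    (X : Set (Fin n → ℝ)) (hX : MeasurableSet X)
    (U : Set (Fin m → ℝ)) (hU : U.Finite) (hUne : U.Nonempty)
    (T : Kernel (X × U) X) [IsMarkovKernel T] (c : X → U → ℝ)
    (β : ℝ) (hβ₀ : 0 < β) (hβ₁ : β < 1)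
    (hmodel : QuantizedMDP.ModelAssumption T c)
    (αc αT : ℝ) (hαc : 0 < αc) (hαT : 0 < αT)
    (hlip : QuantizedMDP.LipschitzAssumption T c αc αT)
    (B : Fin M → Set X) (hB : QuantizedMDP.IsPartition B)
    (x₀ : X)
    -- the representative points: medians of the bins under the occupation measure of a policy
    (γ₀ : QuantizedMDP.StationaryPolicy X U) (y : Fin M → X)
    (hy : ∀ i, QuantizedMDP.IsCoordMedian
      (QuantizedMDP.stateOccupation T β γ₀.toAdmissible x₀) (B i) (y i)) :
    -- the value function of the finite model with Dirac weights at the points `y i` is well defined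
    (∃! J : Fin M → ℝ,
      QuantizedMDP.IsFiniteValue T c β B (fun i => Measure.dirac (y i)) J) ∧
    ∀ J : Fin M → ℝ,
      QuantizedMDP.IsFiniteValue T c β B (fun i => Measure.dirac (y i)) J →
      ENNReal.ofReal
          |QuantizedMDP.extendToStates B J x₀ - QuantizedMDP.optimalCost T c β x₀| ≤
        ENNReal.ofReal (αc + β * αT * QuantizedMDP.costNorm c / (1 - β)) *
          ⨆ γ : QuantizedMDP.StationaryPolicy X U,
            ENNReal.ofReal (1 / (1 - β)) *
              ∑ i, ∫⁻ x in B i, ENNReal.ofReal (QuantizedMDP.l1Dist x.1 (y i).1)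
                ∂(QuantizedMDP.stateOccupation T β γ.toAdmissible x₀) := by
  have : Finite U := hU
  have : Nonempty U := hUne.to_subtype
  refine ⟨hB.existsUnique_isFiniteValue_dirac T c hβ₀.le hβ₁ y, fun J hJ => ?_⟩
  rw [hB.isFiniteValue_dirac_iff T] at hJ
  have hcm : Measurable (Function.uncurry c) := hmodel.cost_continuous.measurable
  have hC (x : X) (u : U) : |c x u| ≤ costNorm c := by
    obtain ⟨K, hK⟩ := hmodel.cost_bounded
    refine le_ciSup (f := fun p : X × U => |c p.1 p.2|) ⟨K, ?_⟩ (x, u)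
    rintro _ ⟨p, rfl⟩
    exact (abs_of_nonneg (hmodel.cost_nonneg _ _)).trans_le (hK _ _)
  have hCnonneg : 0 ≤ costNorm c := (abs_nonneg _).trans (hC x₀ (Classical.arbitrary U))
  have hβ : 0 < 1 - β := by linarith
  have hK : 0 ≤ costNorm c / (1 - β) := by positivity
  have hJK := hB.finiteValue_mem_Icc T hmodel.cost_nonneg (fun x u => (le_abs_self _).trans (hC x u))
    hβ₀.le hβ₁ y hJ
  choose bin hbin using hB.exists_mem
  set h := extendToStates B J with hdef
  set L := αc + β * αT * costNorm c / (1 - β) with hLdef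
  have hL : 0 ≤ L := by positivity
  have hhm : Measurable h := hB.measurable_extendToStates J
  have hhb : ∀ x, |h x| ≤ ‖J‖ := hB.abs_extendToStates_le J
  -- The value at `x` depends on its bin `bin x` only. The point `y (bin x)` may lie in another bin,
  -- so the equation is indexed by the bin and not read off from `h` at that point.
  have hh (x : X) : h x = ⨅ u, oneStepCost T c β h (y (bin x)) u := by
    rw [← hJ, hdef, hB.extendToStates_eq J (hbin x)]
  have hstep (x x' : X) (u : U) :
      oneStepCost T c β h x u - oneStepCost T c β h x' u ≤ L * l1Dist x.1 x'.1 := by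
    have := oneStepCost_sub_le hlip hB hβ₀.le hK hJK x x' u
    rwa [← mul_div_assoc] at this
  have hdiff (γ : AdmissiblePolicy X U) :=
    discountedCost_sub_eq T hβ₀.le hβ₁ γ x₀ hcm hC hhm hhb
  have hQm : Measurable fun p : X × U => oneStepCost T c β h p.1 p.2 - h p.1 :=
    (measurable_oneStepCost T β hcm hhm).sub (hhm.comp measurable_fst)
  have hint (γ : AdmissiblePolicy X U) :=
    integrable_occupationMeasure_of_bound T hβ₀.le hβ₁ γ x₀ hQm fun p =>
      (abs_sub _ _).trans (add_le_add
        (abs_oneStepCost_le T hC hβ₀.le hhb p.1 p.2) (hhb p.1))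
  -- Common end of both sides: a defect dominated by `L` times the distance to the representative,
  -- along one stationary policy, is below the supremum over all of them.
  have hsup (f : StationaryPolicy X U) {g : X × U → ℝ}
      (hg : Integrable g (occupationMeasure T β f.toAdmissible x₀))
      (hgd : ∀ᵐ p ∂occupationMeasure T β f.toAdmissible x₀,
        g p ≤ L * l1Dist p.1.1 (y (bin p.1)).1) :=
    (ofReal_integral_le_mul_lintegral hg hL hgd).trans <| mul_le_mul_right
      ((hB.sum_setLIntegral_stateOccupation T hβ₁ f.toAdmissible x₀
        (d := fun i x => ENNReal.ofReal (l1Dist x.1 (y i).1))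
        (fun i => (measurable_l1Dist_left _).ennreal_ofReal) hbin).symm.le.trans
        (le_iSup (fun γ : StationaryPolicy X U => ENNReal.ofReal (1 / (1 - β)) *
          ∑ i, ∫⁻ x in B i, ENNReal.ofReal (l1Dist x.1 (y i).1)
            ∂(stateOccupation T β γ.toAdmissible x₀)) f)) (ENNReal.ofReal L)
  obtain ⟨f, hf, hopt⟩ := exists_optimal_stationaryPolicy T hmodel hcm hβ₀.le hβ₁ hC x₀
  rcases abs_cases (h x₀ - optimalCost T c β x₀) with ⟨habs, -⟩ | ⟨habs, -⟩ <;> rw [habs]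
  -- Along the optimal policy, `h x ≤ Q(y, u)` for whatever action `u` is taken, so the negated
  -- defect is at most `Q(y, u) - Q(x, u)`.
  · rw [hf, ← neg_sub, hdiff, ← integral_neg]
    refine hsup f (hint f.toAdmissible).neg (ae_of_all _ fun p => ?_)
    have h₁ := ciInf_le (Set.finite_range (oneStepCost T c β h (y (bin p.1)))).bddBelow p.2
    have h₂ := hstep (y (bin p.1)) p.1 p.2
    rw [l1Dist_comm] at h₂
    rw [hh p.1]
    linarith
  -- The policy `g` plays in each bin an action optimal for the finite model, so `h x = Q(y, g x)`
  -- and its defect is `Q(x, g x) - Q(y, g x)`. The selection is measurable because the minimized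
  -- function is bin-wise constant.
  · obtain ⟨g, hg⟩ := exists_stationaryPolicy_eq_ciInf
      (Q := fun x u => oneStepCost T c β h (y (bin x)) u) fun u => by
        have heq : (fun x => oneStepCost T c β h (y (bin x)) u) =
            extendToStates B fun i => oneStepCost T c β h (y i) u :=
          funext fun x =>
            (hB.extendToStates_eq (fun i => oneStepCost T c β h (y i) u) (hbin x)).symm
        rw [heq]
        exact hB.measurable_extendToStates _
    rw [neg_sub]
    refine (ENNReal.ofReal_le_ofReal (sub_le_sub_right (hopt g.toAdmissible) _)).trans ?_
    rw [hdiff]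
    refine hsup g (hint g.toAdmissible) ?_
    filter_upwards [ae_occupationMeasure_toAdmissible T g x₀] with p hp
    rw [hh p.1, ← hg, hp]
    exact hstep _ _ _
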